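/- A characteristic function (CF) is a function $f:\mathbb R\to\mathbb C$ of the form $f(t)=\int e^{itx}\,\mu(dx)$ with $\mu$ a probability measure on $\mathbb R$; it is infinitely divisible (ID) if for every integer $n\ge 1$ there is a CF $f_n$ with $f=f_n^{\,n}$. Let $\varphi(z)=\int_{[0,\infty)}e^{-zu}\,\nu(du)$, $\operatorname{Re} z\ge 0$, be the Laplace transform of a probability measure $\nu$ on $[0,\infty)$. A CF $f$ is called $\varphi$-ID if there are constants $a_n>0$ and CFs $f_n$ $(n\ge1)$ such that $$f(t)=\lim_{n\to\infty}\varphi\{a_n(1-f_n(t))\}\qquad\text{for every } t\in\mathbb R.$$ Theorem. A CF $f$ is $\varphi$-ID if and only if there is a continuous function $\psi:\mathbb R\to\mathbb C$ with $\psi(0)=0$ such that $\omega(t)=e^{-\psi(t)}$ is an infinitely divisible CF (so that $\psi=-\log\omega$, with the usual continuous branch of the logarithm) and $f(t)=\varphi\{\psi(t)\}$ for every $t\in\mathbb R$. -/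

import Mathlib

open MeasureTheory Filter Topology

/-- `f : ℝ → ℂ` is the characteristic function of a probability law on the real line. -/
def IsCharFun (f : ℝ → ℂ) : Prop :=
  ∃ μ : Measure ℝ, IsProbabilityMeasure μ ∧ ∀ t, f t = charFun μ t

/-- `f` is an infinitely divisible characteristic function: for every integer `n ≥ 1` it is the
`n`-th power of some characteristic function. -/
def IsInfDivCharFun (f : ℝ → ℂ) : Prop :=
  IsCharFun f ∧ ∀ n : ℕ, 1 ≤ n → ∃ g : ℝ → ℂ, IsCharFun g ∧ ∀ t, f t = g t ^ n

/-- `φ` is the Laplace transform of a probability law `ν` on `[0, ∞)`, as a function on the closed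
right half-plane, where the integral converges. Values of `φ` elsewhere are unconstrained. -/
def IsLaplaceTransform (φ : ℂ → ℂ) : Prop :=
  ∃ ν : Measure ℝ, IsProbabilityMeasure ν ∧ ν (Set.Iio 0) = 0 ∧
    ∀ z : ℂ, 0 ≤ z.re → φ z = ∫ u, Complex.exp (-z * (u : ℂ)) ∂ν

/-- `f` is `φ`-infinitely divisible: it is the pointwise limit of `φ (aₙ (1 - fₙ t))` for some
positive constants `aₙ` and characteristic functions `fₙ`. (The argument of `φ` has nonnegative
real part, since `‖fₙ t‖ ≤ 1`.) -/
def IsPhiID (φ : ℂ → ℂ) (f : ℝ → ℂ) : Prop :=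
  ∃ (a : ℕ → ℝ) (g : ℕ → ℝ → ℂ), (∀ n, 0 < a n) ∧ (∀ n, IsCharFun (g n)) ∧
    ∀ t, Tendsto (fun n => φ ((a n : ℂ) * (1 - g n t))) atTop (𝓝 (f t))

/-! Suppose `φ(aₙ(1 - gₙ)) → f` and put `ψₙ = aₙ(1 - gₙ)`. The difficulty is that `φ` need not be
invertible, so `ψₙ` must be controlled through `φ(ψₙ)` alone. For each `u ≥ 0`, `exp(-u ψₙ)` is a
compound Poisson CF, so the quadratic-type inequality for `1 - Re` of a CF integrates against `ν` to
one for `φ(ψₙ)` (`IsCharFun.one_sub_re_laplace_add_le`). With convergence to the continuous `f`,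
this makes `φ(ψₙ)` equicontinuous at `0` (`eventually_forall_lt_of_tendsto`). Unless `ν` is the unit
mass at `0`, `φ ≠ 1` on small half-circles about the origin (`laplace_ne_one`), so by connectedness
`ψₙ` cannot cross them and is itself uniformly small near `0`.

Increment bounds then make `ψₙ` pointwise bounded. A limit `ψ` along an ultrafilter is continuous,
and tightness makes every `exp(-ψ/m)` a CF (`exists_exponent_of_equicontinuous`). One limit point
suffices, since continuity of `φ` gives `f = φ(ψ)`.

Conversely, the roots of `ω` are the continuous ones `exp(-ψ/n)`, and `n(1 - exp(-ψ/n)) → ψ`. -/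

/-! ### Closure properties of characteristic functions. -/

theorem isCharFun_one : IsCharFun (fun _ => 1) :=
  ⟨Measure.dirac 0, inferInstance, fun t => by simp [charFun_dirac]⟩

theorem IsCharFun.mul {f g : ℝ → ℂ} (hf : IsCharFun f) (hg : IsCharFun g) :
    IsCharFun (fun t => f t * g t) := by
  obtain ⟨μ, hμ, hf⟩ := hf
  obtain ⟨ν, hν, hg⟩ := hg
  exact ⟨μ.conv ν, inferInstance, fun t => by simp only [charFun_conv, hf, hg]⟩

theorem IsCharFun.pow {f : ℝ → ℂ} (hf : IsCharFun f) (n : ℕ) :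
    IsCharFun (fun t => f t ^ n) := by
  induction n with
  | zero => simpa using isCharFun_one
  | succ n ih => simpa only [pow_succ] using ih.mul hf

theorem IsCharFun.continuous {f : ℝ → ℂ} (hf : IsCharFun f) : Continuous f := by
  obtain ⟨μ, hμ, h⟩ := hf
  rw [show f = charFun μ from funext h]
  fun_prop

theorem IsCharFun.apply_zero {f : ℝ → ℂ} (hf : IsCharFun f) : f 0 = 1 := by
  obtain ⟨μ, hμ, h⟩ := hf
  simp [h]

theorem IsCharFun.norm_le_one {f : ℝ → ℂ} (hf : IsCharFun f) (t : ℝ) : ‖f t‖ ≤ 1 := by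
  obtain ⟨μ, hμ, h⟩ := hf
  rw [h]
  exact norm_charFun_le_one t

theorem IsCharFun.re_le_one {f : ℝ → ℂ} (hf : IsCharFun f) (t : ℝ) : (f t).re ≤ 1 :=
  (Complex.re_le_norm _).trans (hf.norm_le_one t)

/-- A countable mixture of characteristic functions is a characteristic function. -/
theorem IsCharFun.tsum {p : ℕ → ℝ} (hp : ∀ n, 0 ≤ p n) (hp1 : HasSum p 1) {g : ℕ → ℝ → ℂ}
    (hg : ∀ n, IsCharFun (g n)) : IsCharFun (fun t => ∑' n, (p n : ℂ) * g n t) := by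
  choose μ hμ h using hg
  have hprob : IsProbabilityMeasure (Measure.sum fun n => ENNReal.ofReal (p n) • μ n) := by
    constructor
    rw [Measure.sum_apply _ MeasurableSet.univ]
    simp [← ENNReal.ofReal_tsum_of_nonneg hp hp1.summable, hp1.tsum_eq]
  refine ⟨_, hprob, fun t => ?_⟩
  rw [charFun_eq_integral_innerProbChar, integral_sum_measure
    (BoundedContinuousFunction.integrable _ _)]
  refine tsum_congr fun n => ?_
  rw [integral_smul_measure, ENNReal.toReal_ofReal (hp n), ← charFun_eq_integral_innerProbChar,
    h n t, Complex.real_smul]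

/-- The characteristic function of a compound Poisson law. -/
theorem IsCharFun.compoundPoisson {g : ℝ → ℂ} (hg : IsCharFun g) {a : ℝ} (ha : 0 ≤ a) :
    IsCharFun (fun t => Complex.exp (-(a * (1 - g t)))) := by
  have hp := ProbabilityTheory.hasSum_one_poissonMeasure ⟨a, ha⟩
  have := IsCharFun.tsum (fun n => by positivity) hp (fun n => hg.pow n)
  convert this using 2 with t
  have h := (NormedSpace.expSeries_div_hasSum_exp ((a : ℂ) * g t)).mul_left (Complex.exp (-a))
  rw [← Complex.exp_eq_exp_ℂ, ← Complex.exp_add] at h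
  rw [show -((a : ℂ) * (1 - g t)) = -a + a * g t by ring, ← h.tsum_eq]
  refine tsum_congr fun n => ?_
  push_cast
  change _ = Complex.exp (-a) * (a : ℂ) ^ n / _ * _
  ring

/-! ### Increment inequalities for characteristic functions. -/

theorem integrable_expChar (μ : Measure ℝ) [IsFiniteMeasure μ] (t : ℝ) :
    Integrable (fun x : ℝ => Complex.exp (t * x * Complex.I)) μ := by
  refine Integrable.of_bound (by fun_prop) 1 (.of_forall fun x => ?_)
  rw [← Complex.ofReal_mul, Complex.norm_exp_ofReal_mul_I]

theorem integral_complex_re_eq {μ : Measure ℝ} {f : ℝ → ℂ} (hf : Integrable f μ) :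
    ∫ x, (f x).re ∂μ = (∫ x, f x ∂μ).re :=
  Complex.reCLM.integral_comp_comm hf

theorem Complex.sq_norm_one_sub_exp_mul_I (x : ℝ) :
    ‖1 - Complex.exp (x * Complex.I)‖ ^ 2 = 2 * (1 - Complex.exp (x * Complex.I)).re := by
  rw [← Complex.normSq_eq_norm_sq, Complex.normSq_apply]
  simp only [Complex.sub_re, Complex.one_re, Complex.exp_ofReal_mul_I_re, Complex.sub_im,
    Complex.one_im, Complex.exp_ofReal_mul_I_im]
  nlinarith [Real.sin_sq_add_cos_sq x]

/-- `1 - Re g(r)` is the integral of `|1 - e^{irx}|² / 2`; apply the triangle inequality and `(p +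
q)² ≤ 2p² + 2q²` under the integral. -/
theorem IsCharFun.one_sub_re_add_le {g : ℝ → ℂ} (hg : IsCharFun g) (s t : ℝ) :
    1 - (g (s + t)).re ≤ 2 * (1 - (g s).re) + 2 * (1 - (g t).re) := by
  obtain ⟨μ, hμ, h⟩ := hg
  have key (r : ℝ) : 1 - (g r).re = ∫ x : ℝ, (1 - Complex.exp (r * x * Complex.I)).re ∂μ := by
    have hi : Integrable (fun x : ℝ => 1 - Complex.exp (r * x * Complex.I)) μ :=
      (integrable_const _).sub (integrable_expChar μ r)
    rw [h, charFun_apply_real, integral_complex_re_eq hi,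
      integral_sub (integrable_const _) (integrable_expChar μ r)]
    simp
  have hint (r : ℝ) : Integrable (fun x : ℝ => (1 - Complex.exp (r * x * Complex.I)).re) μ :=
    ((integrable_const _).sub (integrable_expChar μ r)).re
  rw [key, key, key, ← integral_const_mul, ← integral_const_mul,
    ← integral_add ((hint s).const_mul 2) ((hint t).const_mul 2)]
  refine integral_mono (hint _) (((hint s).const_mul 2).add ((hint t).const_mul 2)) fun x => ?_
  have e1 := Complex.sq_norm_one_sub_exp_mul_I (s * x)
  have e2 := Complex.sq_norm_one_sub_exp_mul_I (t * x)
  have e3 := Complex.sq_norm_one_sub_exp_mul_I ((s + t) * x)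
  have n1 : ‖Complex.exp ((s * x : ℝ) * Complex.I)‖ = 1 := Complex.norm_exp_ofReal_mul_I _
  have hle : ‖1 - Complex.exp (((s + t) * x : ℝ) * Complex.I)‖ ≤
      ‖1 - Complex.exp ((s * x : ℝ) * Complex.I)‖ + ‖1 - Complex.exp ((t * x : ℝ) * Complex.I)‖ := by
    rw [add_mul, Complex.ofReal_add, add_mul, Complex.exp_add]
    calc _ = ‖(1 - Complex.exp ((s * x : ℝ) * Complex.I)) + Complex.exp ((s * x : ℝ) * Complex.I) *
          (1 - Complex.exp ((t * x : ℝ) * Complex.I))‖ := by congr 1; ring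
      _ ≤ _ := (norm_add_le _ _).trans (by rw [norm_mul, n1, one_mul])
  push_cast at e1 e2 e3 hle ⊢
  nlinarith [norm_nonneg (1 - Complex.exp ((s + t) * x * Complex.I)),
    sq_nonneg (‖1 - Complex.exp (s * x * Complex.I)‖ - ‖1 - Complex.exp (t * x * Complex.I)‖)]

/-- Expand `(1 - e^{itx})(1 - e^{ihx})`, integrate, and use weighted AM-GM. The bound is homogeneous
in `1 - g`, so it survives multiplication by `aₙ`; the free `c` later yields continuity of the limit
exponent. -/
theorem IsCharFun.norm_add_sub_le {g : ℝ → ℂ} (hg : IsCharFun g) (t h : ℝ) {c : ℝ} (hc : 0 < c) :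
    ‖g (t + h) - g t‖ ≤ (1 + c⁻¹) * ‖1 - g h‖ + c * ‖1 - g t‖ := by
  obtain ⟨μ, hμ, hg⟩ := hg
  set e : ℝ → ℝ → ℂ := fun r x => Complex.exp (r * x * Complex.I) with he
  have hi (r : ℝ) : Integrable (e r) μ := integrable_expChar μ r
  have hi1 (r : ℝ) : Integrable (fun x => 1 - e r x) μ := (integrable_const _).sub (hi r)
  have key (r : ℝ) : 1 - g r = ∫ x, (1 - e r x) ∂μ := by
    rw [hg, charFun_apply_real, integral_sub (integrable_const _) (hi r)]
    simp [he]
  have hmul (x : ℝ) : e (t + h) x = e t x * e h x := by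
    simp only [he, ← Complex.exp_add]
    push_cast
    ring_nf
  have hid : g (t + h) - g t = -(1 - g h) + ∫ x, (1 - e t x) * (1 - e h x) ∂μ := by
    have : (fun x => (1 - e t x) * (1 - e h x)) =
        fun x => ((1 - e t x) + (1 - e h x)) - (1 - e (t + h) x) := by
      funext x
      rw [hmul]
      ring
    have hadd : Integrable (fun x => (1 - e t x) + (1 - e h x)) μ := (hi1 t).add (hi1 h)
    rw [this, integral_sub hadd (hi1 _), integral_add (hi1 t) (hi1 h), ← key, ← key,
      ← key]
    ring
  have hre (r : ℝ) : ∫ x, (1 - e r x).re ∂μ ≤ ‖1 - g r‖ := by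
    rw [integral_complex_re_eq (hi1 r), ← key]
    exact Complex.re_le_norm _
  have hb : ‖∫ x, (1 - e t x) * (1 - e h x) ∂μ‖ ≤ c * ‖1 - g t‖ + c⁻¹ * ‖1 - g h‖ := by
    calc _ ≤ ∫ x, (c * (1 - e t x).re + c⁻¹ * (1 - e h x).re) ∂μ := by
          refine norm_integral_le_of_norm_le (((hi1 t).re.const_mul c).add
            ((hi1 h).re.const_mul c⁻¹)) (.of_forall fun x => ?_)
          have e1 := Complex.sq_norm_one_sub_exp_mul_I (t * x)
          have e2 := Complex.sq_norm_one_sub_exp_mul_I (h * x)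
          push_cast at e1 e2
          change ‖1 - e t x‖ ^ 2 = 2 * (1 - e t x).re at e1
          change ‖1 - e h x‖ ^ 2 = 2 * (1 - e h x).re at e2
          change _ ≤ c * (1 - e t x).re + c⁻¹ * (1 - e h x).re
          rw [norm_mul]
          have : c * (1 - e t x).re + c⁻¹ * (1 - e h x).re - ‖1 - e t x‖ * ‖1 - e h x‖ =
              c⁻¹ / 2 * (c * ‖1 - e t x‖ - ‖1 - e h x‖) ^ 2 := by
            rw [show (1 - e t x).re = ‖1 - e t x‖ ^ 2 / 2 by linarith,
              show (1 - e h x).re = ‖1 - e h x‖ ^ 2 / 2 by linarith]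
            field_simp
            ring
          have : 0 ≤ c⁻¹ / 2 * (c * ‖1 - e t x‖ - ‖1 - e h x‖) ^ 2 := by positivity
          linarith
      _ = c * ∫ x, (1 - e t x).re ∂μ + c⁻¹ * ∫ x, (1 - e h x).re ∂μ := by
          have h1 : Integrable (fun x => (1 - e t x).re) μ := (hi1 t).re
          have h2 : Integrable (fun x => (1 - e h x).re) μ := (hi1 h).re
          rw [integral_add (h1.const_mul c) (h2.const_mul c⁻¹), integral_const_mul,
            integral_const_mul]
      _ ≤ _ := by gcongr <;> exact hre _
  calc _ ≤ ‖1 - g h‖ + ‖∫ x, (1 - e t x) * (1 - e h x) ∂μ‖ := by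
        rw [hid]
        exact (norm_add_le _ _).trans (by rw [norm_neg])
    _ ≤ _ := by linarith

/-! ### Equicontinuity at the origin, tightness and limits. -/

/-- A pointwise limit, along an ultrafilter, of characteristic functions that are equicontinuous
at the origin is a characteristic function. -/
theorem isCharFun_of_tendsto_ultrafilter {g : ℕ → ℝ → ℂ} (hg : ∀ n, IsCharFun (g n))
    (hequi : ∀ ε > 0, ∀ᶠ t in 𝓝 (0 : ℝ), ∀ n, ‖1 - g n t‖ ≤ ε) (U : Ultrafilter ℕ) {f : ℝ → ℂ}
    (hlim : ∀ t, Tendsto (fun n => g n t) U (𝓝 (f t))) : IsCharFun f := by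
  choose μ hμ h using hg
  let P : ℕ → ProbabilityMeasure ℝ := fun n => ⟨μ n, hμ n⟩
  have htight : IsTightMeasureSet {((Q : ProbabilityMeasure ℝ) : Measure ℝ) | Q ∈ Set.range P} := by
    rw [isTightMeasureSet_iff_exists_isCompact_measure_compl_le]
    intro ε hε
    obtain ⟨ε', hε', hεε⟩ : ∃ ε' : ℝ, 0 < ε' ∧ ENNReal.ofReal (2 * ε') ≤ ε := by
      by_cases htop : ε = ⊤
      · exact ⟨1, one_pos, by simp [htop]⟩
      · refine ⟨ε.toReal / 2, half_pos (ENNReal.toReal_pos hε.ne' htop), ?_⟩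
        rw [mul_div_cancel₀ _ two_ne_zero, ENNReal.ofReal_toReal htop]
    obtain ⟨δ, hδ, hδ'⟩ := Metric.eventually_nhds_iff.1 (hequi ε' hε')
    -- The truncation inequality integrates over `|t| ≤ 2/r = δ/2`, inside the `δ`-neighbourhood.
    set r : ℝ := 4 / δ with hr
    have hr0 : 0 < r := by positivity
    refine ⟨Metric.closedBall 0 r, isCompact_closedBall _ _, ?_⟩
    rintro _ ⟨_, ⟨n, rfl⟩, rfl⟩
    change μ n _ ≤ ε
    have hset : (Metric.closedBall (0 : ℝ) r)ᶜ = {x | r < |x|} := by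
      ext x
      simp
    have hmeas := measureReal_abs_gt_le_integral_charFun (μ := μ n) hr0
    have hI : ‖∫ t in (-2 * r⁻¹)..(2 * r⁻¹), 1 - charFun (μ n) t‖ ≤
        ε' * |2 * r⁻¹ - (-2 * r⁻¹)| := by
      refine intervalIntegral.norm_integral_le_of_norm_le_const fun t ht => ?_
      rw [← h]
      refine hδ' ?_ n
      rw [Set.uIoc_of_le (by rw [neg_mul]; exact neg_le_self (by positivity))] at ht
      have : 2 * r⁻¹ = δ / 2 := by rw [hr]; field_simp; norm_num
      rw [Real.dist_eq, sub_zero, abs_lt]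
      constructor <;> linarith [ht.1, ht.2]
    have : (μ n).real {x | r < |x|} ≤ 2 * ε' := by
      refine hmeas.trans ((mul_le_mul_of_nonneg_left hI (by positivity)).trans_eq ?_)
      rw [show 2 * r⁻¹ - (-2 * r⁻¹) = 4 * r⁻¹ by ring, abs_of_pos (by positivity)]
      field_simp
      norm_num
    rw [hset, ← ofReal_measureReal]
    exact (ENNReal.ofReal_le_ofReal this).trans hεε
  obtain ⟨Q, -, hQ⟩ := (isCompact_closure_of_isTightMeasureSet htight).ultrafilter_le_nhds (U.map P)
    (.trans (by simp) (monotone_principal subset_closure))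
  have hQ' : Tendsto P U (𝓝 Q) := hQ
  rw [ProbabilityMeasure.tendsto_iff_forall_integral_rclike_tendsto ℂ] at hQ'
  refine ⟨Q, inferInstance, fun t => tendsto_nhds_unique (hlim t) ?_⟩
  simp_rw [h, charFun_eq_integral_innerProbChar]
  exact hQ' _

/-- Functions with `k (s + t) ≤ 2 * k s + 2 * k t` that converge pointwise to a function continuous
at the origin are equicontinuous there. -/
theorem eventually_forall_lt_of_tendsto {k : ℕ → ℝ → ℝ} {l : ℝ → ℝ} (hcont : ∀ n, Continuous (k n))
    (hl : Continuous l) (hnonneg : ∀ n t, 0 ≤ k n t) (hle : ∀ n t, k n t ≤ 2)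
    (hadd : ∀ n s t, k n (s + t) ≤ 2 * k n s + 2 * k n t) (hzero : ∀ n, k n 0 = 0) (hl0 : l 0 = 0)
    (hlim : ∀ t, Tendsto (fun n => k n t) atTop (𝓝 (l t))) {ε : ℝ} (hε : 0 < ε) :
    ∀ᶠ t in 𝓝 (0 : ℝ), ∀ n, k n t < ε := by
  -- With `ε/32` the integral of `l` over `[-2δ, 2δ]` is at most `εδ/8`, strictly below the `εδ/4`
  -- needed for the averaging below.
  obtain ⟨δ, hδ, hδl⟩ : ∃ δ > 0, ∀ t, |t| ≤ 2 * δ → l t ≤ ε / 32 := by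
    have : ∀ᶠ t in 𝓝 (0 : ℝ), l t < ε / 32 :=
      hl.continuousAt.eventually_lt_const (by rw [hl0]; positivity)
    obtain ⟨d, hd, hdl⟩ := Metric.eventually_nhds_iff.1 this
    refine ⟨d / 4, by positivity, fun t ht => (hdl ?_).le⟩
    rw [Real.dist_eq, sub_zero]
    linarith
  have hint (n : ℕ) (a b : ℝ) : IntervalIntegrable (k n) volume a b :=
    (hcont n).intervalIntegrable a b
  have hJ : Tendsto (fun n => ∫ t in (-(2 * δ))..(2 * δ), k n t) atTop
      (𝓝 (∫ t in (-(2 * δ))..(2 * δ), l t)) := by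
    refine intervalIntegral.tendsto_integral_filter_of_dominated_convergence (fun _ => 2)
      (.of_forall fun n => (hcont n).aestronglyMeasurable) (.of_forall fun n => .of_forall fun t _ => ?_)
      (by simp) (.of_forall fun t _ => hlim t)
    rw [Real.norm_of_nonneg (hnonneg n t)]
    exact hle n t
  have hJl : ∫ t in (-(2 * δ))..(2 * δ), l t < ε * δ / 4 := by
    calc _ ≤ ∫ t in (-(2 * δ))..(2 * δ), ε / 32 := by
          refine intervalIntegral.integral_mono_on (by linarith) (hl.intervalIntegrable _ _)
            (by simp) fun t ht => hδl t (abs_le.2 ⟨ht.1, ht.2⟩)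
      _ = ε * δ / 8 := by simp; ring
      _ < _ := by nlinarith [mul_pos hε hδ]
  obtain ⟨N, hN⟩ := eventually_atTop.1 (hJ.eventually_lt_const hJl)
  have hlarge : ∀ᶠ t in 𝓝 (0 : ℝ), ∀ n, N ≤ n → k n t < ε := by
    refine Metric.eventually_nhds_iff.2 ⟨δ, hδ, fun t ht n hn => ?_⟩
    rw [Real.dist_eq, sub_zero, abs_lt] at ht
    have hsub (a b : ℝ) (ha : -(2 * δ) ≤ a) (hab : a ≤ b) (hb : b ≤ 2 * δ) :
        ∫ s in a..b, k n s ≤ ∫ s in (-(2 * δ))..(2 * δ), k n s :=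
      intervalIntegral.integral_mono_interval ha hab hb (.of_forall (hnonneg n)) (hint n _ _)
    have h1 : ∫ s in (0 : ℝ)..δ, k n (t - s) = ∫ s in (t - δ)..t, k n s := by
      rw [intervalIntegral.integral_comp_sub_left (fun s => k n s) t, sub_zero]
    have hct : Continuous fun s => k n (t - s) := (hcont n).comp (by fun_prop)
    -- Average the inequality for `t = (t - s) + s` over `s ∈ [0, δ]`; both resulting integrals lie
    -- within `[-2δ, 2δ]`.
    have h2 : δ * k n t ≤ ∫ s in (0 : ℝ)..δ, (2 * k n (t - s) + 2 * k n s) := by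
      calc δ * k n t = ∫ s in (0 : ℝ)..δ, k n t := by simp
        _ ≤ _ := by
          refine intervalIntegral.integral_mono_on hδ.le (by simp) ?_ fun s _ => ?_
          · exact (Continuous.add (hct.const_mul 2) ((hcont n).const_mul 2)).intervalIntegrable _ _
          · simpa using hadd n (t - s) s
    rw [intervalIntegral.integral_add ((hct.const_mul 2).intervalIntegrable _ _)
      (((hcont n).const_mul 2).intervalIntegrable _ _), intervalIntegral.integral_const_mul,
      intervalIntegral.integral_const_mul, h1] at h2
    have h3 := hsub (t - δ) t (by linarith) (by linarith) (by linarith)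
    have h4 := hsub 0 δ (by linarith) hδ.le (by linarith)
    have h5 := hN n hn
    have h6 : δ * k n t < δ * ε := by linarith
    exact lt_of_mul_lt_mul_left h6 hδ.le
  have hsmall : ∀ᶠ t in 𝓝 (0 : ℝ), ∀ n ∈ {n | n < N}, k n t < ε :=
    (Set.finite_lt_nat N).eventually_all.2 fun n _ =>
      (hcont n).continuousAt.eventually_lt_const (by rwa [hzero])
  filter_upwards [hlarge, hsmall] with t h1 h2 n
  exact (lt_or_ge n N).elim (h2 n) (h1 n)

theorem sq_norm_one_sub_le {w : ℂ} (hw : ‖w‖ ≤ 1) : ‖1 - w‖ ^ 2 ≤ 2 * (1 - w.re) := by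
  have h : ‖w‖ ^ 2 ≤ 1 := by nlinarith [norm_nonneg w]
  rw [← Complex.normSq_eq_norm_sq, Complex.normSq_apply] at h ⊢
  simp only [Complex.sub_re, Complex.one_re, Complex.sub_im, Complex.one_im]
  nlinarith

/-! ### Laplace transforms on the closed half-plane. -/

section Laplace

variable {ν : Measure ℝ}

theorem ae_nonneg_of_measure_Iio (hν0 : ν (Set.Iio 0) = 0) : ∀ᵐ u ∂ν, 0 ≤ u := by
  rw [ae_iff]
  simpa [Set.Iio_def] using hν0

theorem norm_exp_neg_mul_le_one {z : ℂ} (hz : 0 ≤ z.re) {u : ℝ} (hu : 0 ≤ u) :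
    ‖Complex.exp (-z * u)‖ ≤ 1 := by
  rw [Complex.norm_exp, Real.exp_le_one_iff]
  simpa using mul_nonneg hz hu

theorem integrable_laplace [IsFiniteMeasure ν] (hν0 : ν (Set.Iio 0) = 0) {z : ℂ} (hz : 0 ≤ z.re) :
    Integrable (fun u : ℝ => Complex.exp (-z * u)) ν := by
  refine Integrable.of_bound (by fun_prop) 1 ?_
  filter_upwards [ae_nonneg_of_measure_Iio hν0] with u hu
  exact norm_exp_neg_mul_le_one hz hu

theorem continuousOn_laplace [IsFiniteMeasure ν] (hν0 : ν (Set.Iio 0) = 0) :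
    ContinuousOn (fun z : ℂ => ∫ u : ℝ, Complex.exp (-z * u) ∂ν) {z | 0 ≤ z.re} := by
  refine continuousOn_of_dominated (bound := fun _ => 1) (fun z _ => by fun_prop)
    (fun z hz => ?_) (integrable_const _) (.of_forall fun u => by fun_prop)
  filter_upwards [ae_nonneg_of_measure_Iio hν0] with u hu
  exact norm_exp_neg_mul_le_one hz hu

theorem norm_laplace_le_one [IsProbabilityMeasure ν] (hν0 : ν (Set.Iio 0) = 0) {z : ℂ}
    (hz : 0 ≤ z.re) : ‖∫ u : ℝ, Complex.exp (-z * u) ∂ν‖ ≤ 1 := by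
  refine (norm_integral_le_of_norm_le_const (C := 1) ?_).trans (by simp)
  filter_upwards [ae_nonneg_of_measure_Iio hν0] with u hu
  exact norm_exp_neg_mul_le_one hz hu

/-- Near the origin of the closed half-plane, the Laplace transform of a law other than the unit
mass at `0` takes the value `1` only at the origin. -/
theorem laplace_ne_one [IsProbabilityMeasure ν] (hν0 : ν (Set.Iio 0) = 0) {b : ℝ}
    (hb : ν (Set.Ioc 0 b) ≠ 0) {z : ℂ} (hz : 0 ≤ z.re) (hz0 : z ≠ 0) (hzb : ‖z‖ * b < 2 * Real.pi) :
    ∫ u : ℝ, Complex.exp (-z * u) ∂ν ≠ 1 := by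
  intro h
  have hi : Integrable (fun u : ℝ => 1 - Complex.exp (-z * u)) ν :=
    (integrable_const _).sub (integrable_laplace hν0 hz)
  have hzero : ∫ u : ℝ, (1 - Complex.exp (-z * u)).re ∂ν = 0 := by
    rw [integral_complex_re_eq hi, integral_sub (integrable_const _) (integrable_laplace hν0 hz), h]
    simp
  have hnn : 0 ≤ᵐ[ν] fun u : ℝ => (1 - Complex.exp (-z * u)).re := by
    filter_upwards [ae_nonneg_of_measure_Iio hν0] with u hu
    simpa using (Complex.re_le_norm _).trans (norm_exp_neg_mul_le_one hz hu)
  have hae := (integral_eq_zero_iff_of_nonneg_ae hnn hi.re).1 hzero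
  -- The integrand is nonnegative with zero integral, so it vanishes almost everywhere, hence
  -- somewhere on the non-null set `(0, b]`.
  obtain ⟨u, hu, hue⟩ : ∃ u ∈ Set.Ioc 0 b, (1 - Complex.exp (-z * u)).re = 0 := by
    by_contra! hcon
    refine hb (measure_mono_null (fun u hu => ?_) (ae_iff.1 hae))
    exact hcon u hu
  have hre : Real.exp (-(z.re * u)) * Real.cos (z.im * u) = 1 := by
    have : (Complex.exp (-z * u)).re = 1 := by
      rw [Complex.sub_re, Complex.one_re] at hue
      linarith
    rw [Complex.exp_re] at this
    simpa using this
  have h1 : Real.exp (-(z.re * u)) ≤ 1 := Real.exp_le_one_iff.2 (by nlinarith [hu.1])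
  have h2 := Real.cos_le_one (z.im * u)
  have h3 := Real.exp_pos (-(z.re * u))
  have hcos : Real.cos (z.im * u) = 1 := by nlinarith
  have hexp : z.re * u = 0 := by
    rw [hcos, mul_one, Real.exp_eq_one_iff] at hre
    linarith
  have habs : |z.im * u| < 2 * Real.pi := by
    rw [abs_mul, abs_of_pos hu.1]
    exact (mul_le_mul (Complex.abs_im_le_norm z) hu.2 hu.1.le (norm_nonneg _)).trans_lt hzb
  rw [abs_lt] at habs
  rw [Real.cos_eq_one_iff_of_lt_of_lt habs.1 habs.2] at hcos
  exact hz0 (Complex.ext ((mul_eq_zero.1 hexp).resolve_right hu.1.ne')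
    ((mul_eq_zero.1 hcos).resolve_right hu.1.ne'))

theorem IsCharFun.re_mul_one_sub_nonneg {g : ℝ → ℂ} (hg : IsCharFun g) {a : ℝ} (ha : 0 ≤ a) (t : ℝ) :
    0 ≤ ((a : ℂ) * (1 - g t)).re := by
  rw [Complex.re_ofReal_mul, Complex.sub_re, Complex.one_re]
  exact mul_nonneg ha (sub_nonneg.2 (hg.re_le_one t))

/-- For fixed `u` the integrand is a compound Poisson CF of rate `a * u`, and the inequality is
linear, so it can be integrated over `u`. -/
theorem IsCharFun.one_sub_re_laplace_add_le [IsProbabilityMeasure ν] (hν0 : ν (Set.Iio 0) = 0)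
    {g : ℝ → ℂ} (hg : IsCharFun g) {a : ℝ} (ha : 0 ≤ a) {F : ℝ → ℂ}
    (hF : ∀ t, F t = ∫ u : ℝ, Complex.exp (-(a * (1 - g t)) * u) ∂ν) (s t : ℝ) :
    1 - (F (s + t)).re ≤ 2 * (1 - (F s).re) + 2 * (1 - (F t).re) := by
  have hi (r : ℝ) : Integrable (fun u : ℝ => 1 - Complex.exp (-(a * (1 - g r)) * u)) ν :=
    (integrable_const _).sub (integrable_laplace hν0 (hg.re_mul_one_sub_nonneg ha r))
  have hir (r : ℝ) : Integrable (fun u : ℝ => (1 - Complex.exp (-(a * (1 - g r)) * u)).re) ν :=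
    (hi r).re
  have key (r : ℝ) : 1 - (F r).re = ∫ u : ℝ, (1 - Complex.exp (-(a * (1 - g r)) * u)).re ∂ν := by
    rw [integral_complex_re_eq (hi r), integral_sub (integrable_const _)
      (integrable_laplace hν0 (hg.re_mul_one_sub_nonneg ha r)), hF]
    simp
  rw [key, key, key, ← integral_const_mul, ← integral_const_mul,
    ← integral_add ((hir s).const_mul 2) ((hir t).const_mul 2)]
  refine integral_mono_ae (hir _) (((hir s).const_mul 2).add ((hir t).const_mul 2)) ?_
  filter_upwards [ae_nonneg_of_measure_Iio hν0] with u hu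
  have := (hg.compoundPoisson (mul_nonneg ha hu)).one_sub_re_add_le s t
  have e (r : ℝ) : Complex.exp (-(((a * u : ℝ) : ℂ) * (1 - g r))) =
      Complex.exp (-(a * (1 - g r)) * u) := by
    congr 1
    push_cast
    ring
  simpa only [e, Complex.sub_re, Complex.one_re] using this

end Laplace

/-! ### Exponents: confinement near the origin and passage to the limit. -/

/-- A continuous curve starting at the origin of the half-plane stays in a small half-disc as long
as `Φ` stays close to `1` along it, provided that `Φ ≠ 1` on the bounding half-circle. -/
theorem eventually_forall_norm_lt_of_comp {Φ : ℂ → ℂ} (hΦ : ContinuousOn Φ {z | 0 ≤ z.re})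
    {r : ℝ} (hr : 0 < r) (hne : ∀ z : ℂ, 0 ≤ z.re → ‖z‖ = r → Φ z ≠ 1) {ψ : ℕ → ℝ → ℂ}
    (hψ : ∀ n, Continuous (ψ n)) (hψ0 : ∀ n, ψ n 0 = 0) (hre : ∀ n t, 0 ≤ (ψ n t).re)
    (hequi : ∀ ε > 0, ∀ᶠ t in 𝓝 (0 : ℝ), ∀ n, ‖1 - Φ (ψ n t)‖ < ε) :
    ∀ᶠ t in 𝓝 (0 : ℝ), ∀ n, ‖ψ n t‖ < r := by
  set K : Set ℂ := Metric.sphere 0 r ∩ {z | 0 ≤ z.re} with hK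
  have hKc : IsCompact K :=
    (isCompact_sphere _ _).inter_right (isClosed_le continuous_const Complex.continuous_re)
  have hKne : K.Nonempty := ⟨r, by simp [hK, hr.le]⟩
  obtain ⟨w, hw, hmin⟩ := hKc.exists_isMinOn hKne (f := fun z => ‖1 - Φ z‖)
    ((continuousOn_const.sub (hΦ.mono Set.inter_subset_right)).norm)
  have hpos : 0 < ‖1 - Φ w‖ :=
    norm_pos_iff.2 (sub_ne_zero.2 (hne w hw.2 (by simpa using hw.1)).symm)
  obtain ⟨δ, hδ, hδ'⟩ := Metric.eventually_nhds_iff_ball.1 (hequi _ hpos)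
  refine Metric.eventually_nhds_iff_ball.2 ⟨δ, hδ, fun t ht n => ?_⟩
  by_contra! hcon
  have hpre : IsPreconnected (Metric.ball (0 : ℝ) δ) := (convex_ball 0 δ).isPreconnected
  obtain ⟨s, hs, hsr⟩ := hpre.intermediate_value (Metric.mem_ball_self hδ) ht
    (hψ n).norm.continuousOn (show r ∈ Set.Icc ‖ψ n 0‖ ‖ψ n t‖ from ⟨by simp [hψ0, hr.le], hcon⟩)
  have hmem : ψ n s ∈ K := ⟨by simpa using hsr, hre n s⟩
  exact absurd (hδ' s hs n) (not_lt.2 (hmin hmem))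

/-- The exponents of compound Poisson laws that are equicontinuous at the origin have a continuous
limit along any ultrafilter, and this limit is the exponent of an infinitely divisible law. -/
theorem exists_exponent_of_equicontinuous {a : ℕ → ℝ} {g : ℕ → ℝ → ℂ} (ha : ∀ n, 0 < a n)
    (hg : ∀ n, IsCharFun (g n))
    (hequi : ∀ ε > 0, ∀ᶠ t in 𝓝 (0 : ℝ), ∀ n, ‖(a n : ℂ) * (1 - g n t)‖ < ε) (U : Ultrafilter ℕ) :
    ∃ ψ : ℝ → ℂ, Continuous ψ ∧ ψ 0 = 0 ∧ IsInfDivCharFun (fun t => Complex.exp (-ψ t)) ∧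
      ∀ t, Tendsto (fun n => (a n : ℂ) * (1 - g n t)) U (𝓝 (ψ t)) := by
  have hincr (n : ℕ) (t h c : ℝ) (hc : 0 < c) :
      ‖(a n : ℂ) * (1 - g n (t + h)) - a n * (1 - g n t)‖ ≤
        (1 + c⁻¹) * ‖(a n : ℂ) * (1 - g n h)‖ + c * ‖(a n : ℂ) * (1 - g n t)‖ := by
    have := mul_le_mul_of_nonneg_left ((hg n).norm_add_sub_le t h hc) (ha n).le
    rw [show (a n : ℂ) * (1 - g n (t + h)) - a n * (1 - g n t) = -(a n * (g n (t + h) - g n t)) by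
      ring]
    simp only [norm_neg, norm_mul, Complex.norm_of_nonneg (ha n).le]
    linarith
  have hbdd (t : ℝ) : ∃ B, ∀ n, ‖(a n : ℂ) * (1 - g n t)‖ ≤ B := by
    have hscale : ∀ k : ℕ, (∃ B, ∀ n, ‖(a n : ℂ) * (1 - g n (t / 2 ^ k))‖ ≤ B) →
        ∃ B, ∀ n, ‖(a n : ℂ) * (1 - g n t)‖ ≤ B := by
      intro k
      induction k with
      | zero => simp
      | succ k ih =>
        rintro ⟨B, hB⟩
        refine ih ⟨4 * B, fun n => ?_⟩
        -- Equal increments with `c = 1`: doubling the argument multiplies the bound by at most `1 +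
        -- 2 + 1 = 4`.
        have h1 := hincr n (t / 2 ^ (k + 1)) (t / 2 ^ (k + 1)) 1 one_pos
        rw [show t / 2 ^ (k + 1) + t / 2 ^ (k + 1) = t / 2 ^ k by rw [pow_succ]; field_simp; norm_num]
          at h1
        have h2 := norm_sub_norm_le ((a n : ℂ) * (1 - g n (t / 2 ^ k)))
          (a n * (1 - g n (t / 2 ^ (k + 1))))
        have h3 := hB n
        rw [inv_one] at h1
        linarith
    have hlim : Tendsto (fun k : ℕ => t / 2 ^ k) atTop (𝓝 0) := by
      simpa [div_eq_mul_inv] using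
        (tendsto_pow_atTop_nhds_zero_of_lt_one (r := (2⁻¹ : ℝ)) (by norm_num)
          (by norm_num)).const_mul t
    obtain ⟨k, hk⟩ := (hlim.eventually (hequi 1 one_pos)).exists
    exact hscale k ⟨1, fun n => (hk n).le⟩
  have hconv (t : ℝ) : ∃ z, Tendsto (fun n => (a n : ℂ) * (1 - g n t)) U (𝓝 z) := by
    obtain ⟨B, hB⟩ := hbdd t
    obtain ⟨z, -, hz⟩ := (isCompact_closedBall (0 : ℂ) B).ultrafilter_le_nhds
      (U.map fun n => (a n : ℂ) * (1 - g n t)) (by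
        rw [le_principal_iff]
        exact Ultrafilter.mem_map.2 (Filter.univ_mem' fun n => mem_closedBall_zero_iff.2 (hB n)))
    exact ⟨z, hz⟩
  choose ψ hψ using hconv
  have hψincr (t h c : ℝ) (hc : 0 < c) : ‖ψ (t + h) - ψ t‖ ≤ (1 + c⁻¹) * ‖ψ h‖ + c * ‖ψ t‖ :=
    le_of_tendsto_of_tendsto' ((hψ _).sub (hψ _)).norm
      (((hψ h).norm.const_mul _).add ((hψ t).norm.const_mul _)) fun n => hincr n t h c hc
  have hψ0 : ψ 0 = 0 := tendsto_nhds_unique (hψ 0) (by simp [(hg _).apply_zero])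
  have hψsmall : Tendsto ψ (𝓝 0) (𝓝 0) := by
    rw [Metric.tendsto_nhds]
    intro ε hε
    filter_upwards [hequi (ε / 2) (half_pos hε)] with t ht
    rw [dist_zero_right]
    exact (le_of_tendsto' (hψ t).norm fun n => (ht n).le).trans_lt (half_lt_self hε)
  have hψcont : Continuous ψ := by
    rw [continuous_iff_continuousAt]
    intro t
    rw [ContinuousAt, ← map_add_left_nhds_zero t, tendsto_map'_iff, Metric.tendsto_nhds]
    intro ε hε
    -- Fix `c` first, depending on `t`; only then let `h → 0`, which removes the term with `c⁻¹`.
    obtain ⟨c, hc, hct⟩ : ∃ c > 0, c * ‖ψ t‖ < ε / 2 := by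
      refine ⟨ε / (2 * (‖ψ t‖ + 1)), by positivity, ?_⟩
      rw [div_mul_eq_mul_div, div_lt_div_iff₀ (by positivity) two_pos]
      nlinarith [norm_nonneg (ψ t)]
    have h1 : Tendsto (fun h => (1 + c⁻¹) * ‖ψ h‖) (𝓝 0) (𝓝 0) := by
      simpa using hψsmall.norm.const_mul (1 + c⁻¹)
    filter_upwards [h1.eventually_lt_const (half_pos hε)] with h hh
    rw [Function.comp_apply, dist_eq_norm]
    linarith [hψincr t h c hc]
  have hroot (m : ℕ) : IsCharFun (fun t => Complex.exp (-ψ t / (m + 1))) := by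
    have hm : (0 : ℝ) < (m : ℝ) + 1 := by positivity
    have hdiv (n : ℕ) (t : ℝ) : -(((a n / ((m : ℝ) + 1) : ℝ) : ℂ) * (1 - g n t)) =
        -((a n : ℂ) * (1 - g n t)) / (m + 1) := by
      push_cast
      ring
    have hcf (n : ℕ) : IsCharFun (fun t => Complex.exp (-((a n : ℂ) * (1 - g n t)) / (m + 1))) := by
      simpa only [hdiv] using (hg n).compoundPoisson (div_pos (ha n) hm).le
    refine isCharFun_of_tendsto_ultrafilter hcf (fun ε hε => ?_) U fun t => ?_
    · have hF : Tendsto (fun z : ℂ => ‖1 - Complex.exp (-z / (m + 1))‖) (𝓝 0) (𝓝 0) := by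
        have : Continuous fun z : ℂ => ‖1 - Complex.exp (-z / (m + 1))‖ := by fun_prop
        simpa using this.tendsto 0
      obtain ⟨d, hd, hdε⟩ := Metric.eventually_nhds_iff.1 (hF.eventually_lt_const hε)
      filter_upwards [hequi d hd] with t ht n
      exact (hdε (by simpa only [dist_zero_right] using ht n)).le
    · exact (Complex.continuous_exp.tendsto _).comp ((hψ t).neg.div_const _)
  refine ⟨ψ, hψcont, hψ0, ⟨by simpa using hroot 0, fun n hn => ?_⟩, hψ⟩
  obtain ⟨m, rfl⟩ := Nat.exists_eq_add_of_le' hn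
  refine ⟨_, hroot m, fun t => ?_⟩
  rw [← Complex.exp_nat_mul]
  have : (m : ℂ) + 1 ≠ 0 := by exact_mod_cast Nat.succ_ne_zero m
  push_cast
  field_simp

/-! ### Continuous roots of `exp (-ψ)`. -/

/-- The distinguished roots of `exp (-ψ)` are the only continuous ones that are `1` at `0`. -/
theorem eq_exp_neg_div_of_pow_eq {ψ g : ℝ → ℂ} (hψ : Continuous ψ) (hψ0 : ψ 0 = 0)
    (hg : Continuous g) (hg0 : g 0 = 1) {n : ℕ} (hn : n ≠ 0)
    (hpow : ∀ t, Complex.exp (-ψ t) = g t ^ n) (t : ℝ) : g t = Complex.exp (-ψ t / n) := by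
  have hn' : (n : ℂ) ≠ 0 := Nat.cast_ne_zero.2 hn
  set q : ℝ → ℂ := fun t => g t * Complex.exp (ψ t / n) with hq
  have hqc : Continuous q := by fun_prop
  have hqn (t : ℝ) : q t ∈ {z : ℂ | z ^ n = 1} := by
    rw [Set.mem_ofPred_eq, hq, mul_pow, ← hpow, ← Complex.exp_nat_mul, ← Complex.exp_add]
    rw [mul_div_cancel₀ _ hn', neg_add_cancel, Complex.exp_zero]
  have hfin : {z : ℂ | z ^ n = 1}.Finite := by
    have := (Polynomial.nthRootsFinset n (1 : ℂ)).finite_toSet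
    refine this.subset fun z hz => ?_
    simpa [Polynomial.mem_nthRootsFinset (Nat.pos_of_ne_zero hn)] using hz
  -- A connected set of roots of unity is a single point.
  have himg : (Set.range q).Subsingleton :=
    hfin.countable.isTotallyDisconnected _ (Set.range_subset_iff.2 hqn) (isPreconnected_range hqc)
  have h1 : q t = 1 := by
    rw [himg ⟨t, rfl⟩ ⟨0, rfl⟩, hq]
    simp [hg0, hψ0]
  rw [neg_div, Complex.exp_neg]
  exact eq_inv_of_mul_eq_one_left h1

/-- This is the derivative of `1 - exp(-z x)` at `x = 0`, sampled at `x = 1/(n + 1)`. -/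
theorem tendsto_mul_one_sub_exp_neg_div (z : ℂ) :
    Tendsto (fun n : ℕ => ((n : ℂ) + 1) * (1 - Complex.exp (-z / (n + 1)))) atTop (𝓝 z) := by
  have hd : HasDerivAt (fun x : ℂ => 1 - Complex.exp (-z * x)) z 0 := by
    have := (((hasDerivAt_id (0 : ℂ)).const_mul (-z)).cexp).const_sub 1
    simpa using this
  have hx : Tendsto (fun n : ℕ => (1 : ℂ) / ((n : ℂ) + 1)) atTop (𝓝[≠] 0) := by
    refine tendsto_nhdsWithin_iff.2 ⟨tendsto_one_div_add_atTop_nhds_zero_nat, .of_forall fun n => ?_⟩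
    exact one_div_ne_zero (by exact_mod_cast Nat.succ_ne_zero n)
  refine (hd.tendsto_slope_zero.comp hx).congr fun n => ?_
  simp [div_eq_mul_inv]

/-! ### The characterization. -/

/-- Continuity of `ψ` together with `ψ 0 = 0` says that `ψ = -log ω` is the usual (distinguished)
branch of the logarithm of `ω = exp (-ψ)`. -/
theorem theorem2p1 (φ : ℂ → ℂ) (hφ : IsLaplaceTransform φ) (f : ℝ → ℂ) (hf : IsCharFun f) :
    IsPhiID φ f ↔
      ∃ ψ : ℝ → ℂ, Continuous ψ ∧ ψ 0 = 0 ∧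
        IsInfDivCharFun (fun t => Complex.exp (-ψ t)) ∧ ∀ t, f t = φ (ψ t) := by
  obtain ⟨ν, hν, hν0, hφν⟩ := hφ
  have hφc : ContinuousOn φ {z | 0 ≤ z.re} := (continuousOn_laplace hν0).congr hφν
  have hclosed : IsClosed {z : ℂ | 0 ≤ z.re} := isClosed_le continuous_const Complex.continuous_re
  constructor
  · rintro ⟨a, g, ha, hg, hlim⟩
    have hre (n : ℕ) (t : ℝ) : 0 ≤ ((a n : ℂ) * (1 - g n t)).re :=
      (hg n).re_mul_one_sub_nonneg (ha n).le t
    -- If `ν` is the unit mass at `0`, then `φ = 1` on the half-plane and nothing controls `ψₙ`; but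
    -- `f = 1`, and `ψ = 0` works.
    by_cases hdeg : ν (Set.Ioi 0) = 0
    · have hae : ∀ᵐ u ∂ν, u = 0 := by
        have : ∀ᵐ u ∂ν, ¬ 0 < u := by simpa [ae_iff, Set.Ioi_def] using hdeg
        filter_upwards [ae_nonneg_of_measure_Iio hν0, this] with u h1 h2
        exact le_antisymm (not_lt.1 h2) h1
      have hφ1 (z : ℂ) (hz : 0 ≤ z.re) : φ z = 1 := by
        rw [hφν z hz, integral_congr_ae (g := fun _ => (1 : ℂ))
          (by filter_upwards [hae] with u hu; simp [hu])]
        simp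
      refine ⟨fun _ => 0, continuous_const, rfl, ?_, fun t => ?_⟩
      · simp only [neg_zero, Complex.exp_zero]
        exact ⟨isCharFun_one, fun n _ => ⟨_, isCharFun_one, fun t => by simp⟩⟩
      · rw [hφ1 0 le_rfl]
        refine tendsto_nhds_unique (hlim t) ?_
        simp [hφ1 _ (hre _ t)]
    obtain ⟨b, hb⟩ : ∃ b : ℕ, ν (Set.Ioc 0 (b : ℝ)) ≠ 0 := by
      by_contra! hcon
      refine hdeg (measure_mono_null (fun u hu => ?_) (measure_iUnion_null hcon))
      obtain ⟨n, hn⟩ := exists_nat_ge u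
      exact Set.mem_iUnion.2 ⟨n, hu, hn⟩
    have hψc (n : ℕ) : Continuous fun t => (a n : ℂ) * (1 - g n t) :=
      continuous_const.mul (continuous_const.sub (hg n).continuous)
    have hψ0 (n : ℕ) : (a n : ℂ) * (1 - g n 0) = 0 := by simp [(hg n).apply_zero]
    have hFc (n : ℕ) : Continuous fun t => φ ((a n : ℂ) * (1 - g n t)) :=
      hφc.comp_continuous (hψc n) (hre n)
    have hF1 (n : ℕ) (t : ℝ) : ‖φ ((a n : ℂ) * (1 - g n t))‖ ≤ 1 := by
      rw [hφν _ (hre n t)]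
      exact norm_laplace_le_one hν0 (hre n t)
    have hφ0 : φ 0 = 1 := by simp [hφν 0 le_rfl]
    have hequiF (ε : ℝ) (hε : 0 < ε) :
        ∀ᶠ t in 𝓝 (0 : ℝ), ∀ n, ‖1 - φ ((a n : ℂ) * (1 - g n t))‖ < ε := by
      have := eventually_forall_lt_of_tendsto
        (k := fun n t => 1 - (φ ((a n : ℂ) * (1 - g n t))).re) (l := fun t => 1 - (f t).re)
        (fun n => continuous_const.sub (Complex.continuous_re.comp (hFc n)))
        (continuous_const.sub (Complex.continuous_re.comp hf.continuous))
        (fun n t => sub_nonneg.2 ((Complex.re_le_norm _).trans (hF1 n t)))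
        (fun n t => by linarith [(abs_le.1 ((Complex.abs_re_le_norm _).trans (hF1 n t))).1])
        (fun n s t => (hg n).one_sub_re_laplace_add_le hν0 (ha n).le
          (F := fun t => φ ((a n : ℂ) * (1 - g n t))) (fun t => hφν _ (hre n t)) s t)
        (fun n => by simp only [hψ0, hφ0, Complex.one_re, sub_self])
        (by simp [hf.apply_zero])
        (fun t => ((Complex.continuous_re.tendsto _).comp (hlim t)).const_sub 1)
        (ε := ε ^ 2 / 2) (by positivity)
      filter_upwards [this] with t ht n
      refine lt_of_pow_lt_pow_left₀ 2 hε.le ((sq_norm_one_sub_le (hF1 n t)).trans_lt ?_)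
      linarith [ht n]
    have hequi (ε : ℝ) (hε : 0 < ε) :
        ∀ᶠ t in 𝓝 (0 : ℝ), ∀ n, ‖(a n : ℂ) * (1 - g n t)‖ < ε := by
      -- The second term keeps `r * b < 1`, so that on `|z| = r` the phases `Im z * u`, `u ≤ b`,
      -- cannot reach a nonzero multiple of `2π`.
      set r : ℝ := min ε (1 / ((b : ℝ) + 1)) with hr
      have hr0 : 0 < r := lt_min hε (by positivity)
      have hrb : r * b < 2 * Real.pi := by
        have h1 : r * b ≤ 1 / ((b : ℝ) + 1) * b := by
          gcongr
          exact min_le_right _ _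
        have h2 : 1 / ((b : ℝ) + 1) * b ≤ 1 := by
          rw [div_mul_eq_mul_div, div_le_one (by positivity)]
          linarith
        linarith [Real.pi_gt_three]
      have := eventually_forall_norm_lt_of_comp hφc hr0 (fun z hz hzr => by
        rw [hφν z hz]
        refine laplace_ne_one hν0 hb hz (fun h => ?_) (by rwa [hzr])
        rw [h, norm_zero] at hzr
        exact hr0.ne hzr) hψc hψ0 hre hequiF
      filter_upwards [this] with t ht n
      exact (ht n).trans_le (min_le_left _ _)
    obtain ⟨ψ, hψ, hψz, hid, hψlim⟩ :=
      exists_exponent_of_equicontinuous ha hg hequi (hyperfilter ℕ)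
    refine ⟨ψ, hψ, hψz, hid, fun t => ?_⟩
    have hmem : 0 ≤ (ψ t).re :=
      hclosed.mem_of_tendsto (hψlim t) (.of_forall fun n => hre n t)
    refine tendsto_nhds_unique ((hlim t).mono_left Nat.hyperfilter_le_atTop) ?_
    exact (hφc _ hmem).tendsto.comp
      (tendsto_nhdsWithin_iff.2 ⟨hψlim t, .of_forall fun n => hre n t⟩)
  · rintro ⟨ψ, hψ, hψ0, ⟨-, hroot⟩, hfψ⟩
    have hcf (n : ℕ) : IsCharFun fun t => Complex.exp (-ψ t / (n + 1)) := by
      obtain ⟨g, hg, hpow⟩ := hroot (n + 1) (Nat.le_add_left 1 n)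
      have := eq_exp_neg_div_of_pow_eq hψ hψ0 hg.continuous hg.apply_zero n.succ_ne_zero hpow
      push_cast at this
      rwa [show g = _ from funext this] at hg
    refine ⟨fun n => n + 1, fun n t => Complex.exp (-ψ t / (n + 1)), fun n => by positivity, hcf,
      fun t => ?_⟩
    have hre (n : ℕ) : 0 ≤ (((n + 1 : ℝ) : ℂ) * (1 - Complex.exp (-ψ t / (n + 1)))).re :=
      (hcf n).re_mul_one_sub_nonneg (by positivity) t
    have hlim : Tendsto (fun n : ℕ => ((n + 1 : ℝ) : ℂ) * (1 - Complex.exp (-ψ t / (n + 1)))) atTop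
        (𝓝 (ψ t)) := by
      simpa using tendsto_mul_one_sub_exp_neg_div (ψ t)
    have hmem : 0 ≤ (ψ t).re := hclosed.mem_of_tendsto hlim (.of_forall hre)
    rw [hfψ]
    exact (hφc _ hmem).tendsto.comp (tendsto_nhdsWithin_iff.2 ⟨hlim, .of_forall hre⟩)
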